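/- Let $\mathbf{k}$ be a commutative ring, and let $\operatorname{QSym}$ be the $\mathbf{k}$-algebra of quasisymmetric functions in the variables $x_1,x_2,x_3,\dots$ over $\mathbf{k}$, i.e. of the bounded-degree power series $f\in\mathbf{k}[[x_1,x_2,\dots]]$ such that, for all nonnegative integers $a_1,\dots,a_p$ and all $i_1<\dots<i_p$, the coefficients of $x_1^{a_1}\cdots x_p^{a_p}$ and of $x_{i_1}^{a_1}\cdots x_{i_p}^{a_p}$ in $f$ are equal. For a composition $\alpha=(\alpha_1,\dots,\alpha_p)$ of $n\in\{0,1,2,\dots\}$, write $\ell(\alpha)=p$, $\operatorname{rev}\alpha=(\alpha_p,\dots,\alpha_1)$, $\operatorname{Des}(\alpha)=\{\alpha_1,\alpha_1+\alpha_2,\dots,\alpha_1+\dots+\alpha_{p-1}\}$ and $M_\alpha=\sum_{i_1<\dots<i_p}x_{i_1}^{\alpha_1}\cdots x_{i_p}^{\alpha_p}$. The $M_\alpha$ form a basis of $\operatorname{QSym}$. Let $$\eta_\alpha=\sum_{\beta\text{ a composition of }n,\ \operatorname{Des}(\beta)\subseteq\operatorname{Des}(\alpha)}2^{\ell(\beta)}M_\beta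 .$$ Equip $\operatorname{QSym}$ with the $\mathbf{k}$-linear coproduct $\Delta(M_\alpha)=\sum_{m=0}^{p}M_{(\alpha_1,\dots,\alpha_m)}\otimes M_{(\alpha_{m+1},\dots,\alpha_p)}$ and the counit $\varepsilon(f)=f(0,0,\dots)$. An antipode of $\operatorname{QSym}$ is a $\mathbf{k}$-linear map $S:\operatorname{QSym}\to\operatorname{QSym}$ with $\mu\circ(S\otimes\operatorname{id})\circ\Delta=u\circ\varepsilon=\mu\circ(\operatorname{id}\otimes S)\circ\Delta$, where $\mu$ is the multiplication and $u:\mathbf{k}\to\operatorname{QSym}$, $c\mapsto c\cdot 1$, is the unit map. Then $\operatorname{QSym}$ has exactly one antipode $S$, and for every $n\in\{0,1,2,\dots\}$ and every composition $\alpha$ of $n$, $$S(\eta_\alpha)=(-1)^{\ell(\alpha)}\,\eta_{\operatorname{rev}\alpha}.$$ -/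

import Mathlib

namespace QuasiSym

open Finset

open scoped TensorProduct

universe u

/-- The exponent vector of the monomial `x_{i_1}^{a_1} x_{i_2}^{a_2} ⋯ x_{i_p}^{a_p}`
in the variables `x_1, x_2, x_3, …` (indexed by the positive integers). -/
noncomputable def expo {p : ℕ} (i : Fin p → ℕ+) (a : Fin p → ℕ) : ℕ+ →₀ ℕ :=
  ∑ j, Finsupp.single (i j) (a j)

/-- The first `p` variable indices `1 < 2 < ⋯ < p`. -/
def initial (p : ℕ) : Fin p → ℕ+ := fun j => Nat.succPNat j

/-- The total degree of the power series is bounded. -/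
def BoundedDegree {k : Type u} [CommRing k] (f : MvPowerSeries ℕ+ k) : Prop :=
  ∃ N : ℕ, ∀ d : ℕ+ →₀ ℕ, N < d.degree → MvPowerSeries.coeff d f = 0

/-- For all nonnegative `a_1, …, a_p` and all `i_1 < ⋯ < i_p`, the coefficients of
`x_1^{a_1} ⋯ x_p^{a_p}` and of `x_{i_1}^{a_1} ⋯ x_{i_p}^{a_p}` agree. -/
def ShiftInvariant {k : Type u} [CommRing k] (f : MvPowerSeries ℕ+ k) : Prop :=
  ∀ (p : ℕ) (a : Fin p → ℕ) (i : Fin p → ℕ+), StrictMono i →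
    MvPowerSeries.coeff (expo (initial p) a) f = MvPowerSeries.coeff (expo i a) f

lemma initial_strictMono (p : ℕ) : StrictMono (initial p) := by
  intro a b h
  simpa [initial] using h

lemma expo_apply {p : ℕ} {i : Fin p → ℕ+} (hi : Function.Injective i) (a : Fin p → ℕ)
    (j : Fin p) : expo i a (i j) = a j := by
  classical
  simp [expo, Finsupp.finsetSum_apply, Finsupp.single_apply, hi.eq_iff]

lemma expo_apply_of_notMem {p : ℕ} {i : Fin p → ℕ+} (a : Fin p → ℕ) {m : ℕ+}
    (hm : m ∉ Set.range i) : expo i a m = 0 := by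
  classical
  simp only [expo, Finsupp.finsetSum_apply, Finsupp.single_apply]
  refine Finset.sum_eq_zero fun j _ => ?_
  rw [if_neg]
  exact fun h => hm ⟨j, h⟩

lemma expo_add {p : ℕ} (i : Fin p → ℕ+) (a b : Fin p → ℕ) :
    expo i (a + b) = expo i a + expo i b := by
  simp [expo, Finset.sum_add_distrib]

lemma expo_comp_self {p : ℕ} {i : Fin p → ℕ+} (hi : Function.Injective i) (d : ℕ+ →₀ ℕ)
    (hd : ∀ m, m ∉ Set.range i → d m = 0) : expo i (fun j => d (i j)) = d := by
  ext m
  by_cases hm : m ∈ Set.range i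
  · obtain ⟨j, rfl⟩ := hm
    exact expo_apply hi _ j
  · rw [expo_apply_of_notMem _ hm, hd m hm]

lemma coeff_mul_expo {k : Type u} [CommRing k] (f g : MvPowerSeries ℕ+ k) {p : ℕ}
    {i : Fin p → ℕ+} (hi : Function.Injective i) (a : Fin p → ℕ) :
    MvPowerSeries.coeff (expo i a) (f * g) =
      ∑ q ∈ Finset.HasAntidiagonal.antidiagonal (Finsupp.equivFunOnFinite.symm a),
        MvPowerSeries.coeff (expo i q.1) f * MvPowerSeries.coeff (expo i q.2) g := by
  classical
  rw [MvPowerSeries.coeff_mul]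
  symm
  refine Finset.sum_nbij' (fun q => (expo i q.1, expo i q.2))
    (fun q => (Finsupp.equivFunOnFinite.symm fun j => q.1 (i j),
      Finsupp.equivFunOnFinite.symm fun j => q.2 (i j))) ?_ ?_ ?_ ?_ ?_
  · rintro ⟨b, c⟩ h
    rw [Finset.HasAntidiagonal.mem_antidiagonal] at h ⊢
    have h2 : (⇑b + ⇑c : Fin p → ℕ) = a := by
      have := congrArg (fun x : Fin p →₀ ℕ => ⇑x) h
      simpa using this
    simp only
    rw [← expo_add, h2]
  · rintro ⟨b, c⟩ h
    rw [Finset.HasAntidiagonal.mem_antidiagonal] at h ⊢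
    ext j
    have := congrArg (fun x : ℕ+ →₀ ℕ => x (i j)) h
    simpa [expo_apply hi] using this
  · rintro ⟨b, c⟩ _
    ext j <;> simp [expo_apply hi]
  · rintro ⟨b, c⟩ h
    rw [Finset.HasAntidiagonal.mem_antidiagonal] at h
    have hz : ∀ m, m ∉ Set.range i → b m = 0 ∧ c m = 0 := by
      intro m hm
      have := congrArg (fun x : ℕ+ →₀ ℕ => x m) h
      simp only [Finsupp.add_apply, expo_apply_of_notMem _ hm] at this
      omega
    simp only [Finsupp.coe_equivFunOnFinite_symm, Prod.mk.injEq]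
    exact ⟨expo_comp_self hi b fun m hm => (hz m hm).1,
      expo_comp_self hi c fun m hm => (hz m hm).2⟩
  · rintro ⟨b, c⟩ _
    rfl

lemma expo_eq_zero_iff {p : ℕ} {i : Fin p → ℕ+} (hi : Function.Injective i) (a : Fin p → ℕ) :
    expo i a = 0 ↔ a = 0 := by
  constructor
  · intro h
    ext j
    rw [← expo_apply hi a j, h]; rfl
  · rintro rfl
    simp [expo]

end QuasiSym

open QuasiSym in
/-- The ring of quasisymmetric functions over `k` in the variables `x_1, x_2, x_3, …`. -/
def QSym (k : Type*) [CommRing k] : Subalgebra k (MvPowerSeries ℕ+ k) where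
  carrier := {f | BoundedDegree f ∧ ShiftInvariant f}
  mul_mem' := by
    rintro f g ⟨⟨N, hN⟩, hf⟩ ⟨⟨N', hN'⟩, hg⟩
    refine ⟨⟨N + N', fun d hd => ?_⟩, fun p a i hi => ?_⟩
    · classical
      rw [MvPowerSeries.coeff_mul]
      refine Finset.sum_eq_zero ?_
      rintro ⟨b, c⟩ h
      rw [Finset.HasAntidiagonal.mem_antidiagonal] at h
      have hdeg : b.degree + c.degree = d.degree := by rw [← h, map_add]
      rcases lt_or_ge N b.degree with hb | hb
      · simp [hN b hb]
      · simp [hN' c (by omega)]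
    · rw [coeff_mul_expo _ _ hi.injective, coeff_mul_expo _ _ (initial_strictMono p).injective]
      refine Finset.sum_congr rfl fun q _ => ?_
      rw [hf p _ i hi, hg p _ i hi]
  add_mem' := by
    rintro f g ⟨⟨N, hN⟩, hf⟩ ⟨⟨N', hN'⟩, hg⟩
    refine ⟨⟨N + N', fun d hd => ?_⟩, fun p a i hi => ?_⟩
    · rw [map_add, hN d (by omega), hN' d (by omega), add_zero]
    · rw [map_add, map_add, hf p a i hi, hg p a i hi]
  algebraMap_mem' := by
    intro r
    have key : ∀ d : ℕ+ →₀ ℕ, MvPowerSeries.coeff d (algebraMap k (MvPowerSeries ℕ+ k) r) =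
        if d = 0 then r else 0 := by
      classical
      intro d
      rw [MvPowerSeries.algebraMap_apply, MvPowerSeries.coeff_C]
      rfl
    refine ⟨⟨0, fun d hd => ?_⟩, fun p a i hi => ?_⟩
    · rw [key, if_neg]
      rintro rfl
      simp at hd
    · rw [key, key]
      simp only [expo_eq_zero_iff hi.injective, expo_eq_zero_iff (initial_strictMono p).injective]

namespace QuasiSym

open Finset

open scoped TensorProduct

universe u

open Classical in
/-- The monomial quasisymmetric power series
`M_α = ∑_{i_1 < ⋯ < i_p} x_{i_1}^{α_1} ⋯ x_{i_p}^{α_p}`. Since all `α_j` are positive, distinct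
`i` give distinct monomials, so each monomial of this form has coefficient `1`. -/
noncomputable def monomialSeries (k : Type u) [CommRing k] {n : ℕ} (α : Composition n) :
    MvPowerSeries ℕ+ k :=
  fun d => if ∃ i : Fin α.length → ℕ+, StrictMono i ∧ d = expo i α.blocksFun then 1 else 0

/-- The list of nonzero exponents of a monomial, in the order of the variables. -/
def flat (d : ℕ+ →₀ ℕ) : List ℕ := (d.support.sort (· ≤ ·)).map d

lemma flat_expo {p : ℕ} {i : Fin p → ℕ+} (hi : StrictMono i) (a : Fin p → ℕ) :
    flat (expo i a) = (List.ofFn a).filter (· ≠ 0) := by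
  classical
  have hs : (expo i a).support.sort (· ≤ ·) =
      ((List.finRange p).filter (fun j => a j ≠ 0)).map i := by
    symm
    have hsorted : (((List.finRange p).filter (fun j => a j ≠ 0)).map i).SortedLT := by
      refine List.Pairwise.sortedLT ?_
      rw [List.pairwise_map]
      refine List.Pairwise.filter _ ?_
      exact (List.pairwise_lt_finRange p).imp fun h => hi h
    have hfin : (expo i a).support =
        (((List.finRange p).filter (fun j => a j ≠ 0)).map i).toFinset := by
      ext m
      simp only [Finsupp.mem_support_iff, List.mem_toFinset, List.mem_map, List.mem_filter,
        List.mem_finRange, true_and, decide_eq_true_eq]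
      constructor
      · intro h
        by_cases hm : m ∈ Set.range i
        · obtain ⟨j, rfl⟩ := hm
          rw [expo_apply hi.injective] at h
          exact ⟨j, h, rfl⟩
        · exact absurd (expo_apply_of_notMem a hm) h
      · rintro ⟨j, hj, rfl⟩
        rwa [expo_apply hi.injective]
    rw [hfin]
    exact ((List.toFinset_sort (· ≤ ·) hsorted.nodup).2 hsorted.sortedLE.pairwise).symm
  rw [flat, hs, List.map_map, List.ofFn_eq_map, List.filter_map]
  simp only [Function.comp_def, expo_apply hi.injective]

lemma flat_expo_blocks {n : ℕ} (α : Composition n) {i : Fin α.length → ℕ+} (hi : StrictMono i) :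
    flat (expo i α.blocksFun) = α.blocks := by
  rw [flat_expo hi, α.ofFn_blocksFun, List.filter_eq_self]
  intro b hb
  simpa using (α.blocks_pos hb).ne'

lemma exists_expo_of_flat {n : ℕ} (α : Composition n) {d : ℕ+ →₀ ℕ} (h : flat d = α.blocks) :
    ∃ i : Fin α.length → ℕ+, StrictMono i ∧ d = expo i α.blocksFun := by
  have hlen : d.support.card = α.length := by
    rw [← α.blocks_length, ← h, flat, List.length_map, Finset.length_sort]
  refine ⟨d.support.orderEmbOfFin hlen, (d.support.orderEmbOfFin hlen).strictMono, ?_⟩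
  have hb : α.blocksFun = fun j => d (d.support.orderEmbOfFin hlen j) := by
    ext j
    simp only [Composition.blocksFun, List.get_eq_getElem, ← h, flat, List.getElem_map,
      Finset.orderEmbOfFin_apply]
    rfl
  rw [hb, expo_comp_self (d.support.orderEmbOfFin hlen).injective]
  intro m hm
  rw [Finset.range_orderEmbOfFin] at hm
  simpa using hm

lemma coeff_monomialSeries (k : Type u) [CommRing k] {n : ℕ} (α : Composition n)
    (d : ℕ+ →₀ ℕ) :
    MvPowerSeries.coeff d (monomialSeries k α) = if flat d = α.blocks then 1 else 0 := by
  classical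
  rw [MvPowerSeries.coeff_apply, monomialSeries]
  congr 1
  refine propext ⟨?_, exists_expo_of_flat α⟩
  rintro ⟨i, hi, rfl⟩
  exact flat_expo_blocks α hi

lemma sum_flat (d : ℕ+ →₀ ℕ) : (flat d).sum = d.degree := by
  have h : (d.support.val.map d).sum = ((d.support.sort (· ≤ ·) : Multiset ℕ+).map d).sum := by
    rw [Finset.sort_eq]
  rw [flat, Finsupp.degree_apply, Finset.sum_eq_multiset_sum, h, Multiset.map_coe,
    Multiset.sum_coe]

/-- The monomial quasisymmetric function `M_α` as an element of `QSym`. -/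
noncomputable def M (k : Type u) [CommRing k] {n : ℕ} (α : Composition n) : QSym k :=
  ⟨monomialSeries k α, by
    refine ⟨⟨n, fun d hd => ?_⟩, fun p a i hi => ?_⟩
    · rw [coeff_monomialSeries, if_neg]
      intro h
      rw [← sum_flat, h, α.blocks_sum] at hd
      exact lt_irrefl _ hd
    · rw [coeff_monomialSeries, coeff_monomialSeries, flat_expo hi,
        flat_expo (initial_strictMono p)]⟩

/-- The monomial `x_1^{α_1} ⋯ x_p^{α_p}`. -/
noncomputable def leading (α : Σ n, Composition n) : ℕ+ →₀ ℕ :=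
  expo (initial α.2.length) α.2.blocksFun

lemma flat_leading (α : Σ n, Composition n) : flat (leading α) = α.2.blocks :=
  flat_expo_blocks α.2 (initial_strictMono _)

lemma degree_leading (α : Σ n, Composition n) : (leading α).degree = α.1 := by
  rw [← sum_flat, flat_leading, α.2.blocks_sum]

lemma coeff_leading_M (k : Type u) [CommRing k] (α β : Σ n, Composition n) :
    MvPowerSeries.coeff (leading β) (M k α.2 : MvPowerSeries ℕ+ k) =
      Finsupp.single α (1 : k) β := by
  classical
  rw [M, coeff_monomialSeries, flat_leading, Finsupp.single_apply]
  congr 1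
  rw [← Composition.sigma_eq_iff_blocks_eq]
  exact propext eq_comm

lemma coeff_eq_coeff_leading {k : Type u} [CommRing k] (f : QSym k) (d : ℕ+ →₀ ℕ) :
    ∃ α : Σ n, Composition n, MvPowerSeries.coeff d (f : MvPowerSeries ℕ+ k) =
      MvPowerSeries.coeff (leading α) (f : MvPowerSeries ℕ+ k) := by
  let α : Σ n, Composition n := ⟨(flat d).sum, ⟨flat d, by
    intro b hb
    simp only [flat, List.mem_map, Finset.mem_sort, Finsupp.mem_support_iff] at hb
    obtain ⟨m, hm, rfl⟩ := hb
    omega, rfl⟩⟩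
  obtain ⟨i, hi, hd⟩ := exists_expo_of_flat α.2 (d := d) rfl
  refine ⟨α, ?_⟩
  rw [hd]
  exact (f.2.2 _ _ i hi).symm

/-- The family of coefficients of `x_1^{α_1} ⋯ x_p^{α_p}` in a quasisymmetric function, where
`α` ranges over all compositions. -/
noncomputable def coeffs (k : Type u) [CommRing k] : QSym k →ₗ[k] ((Σ n, Composition n) →₀ k) where
  toFun f := Finsupp.ofSupportFinite
    (fun α => MvPowerSeries.coeff (leading α) (f : MvPowerSeries ℕ+ k)) (by
      obtain ⟨N, hN⟩ := f.2.1
      refine ((Finset.range (N + 1)).sigma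
        (fun n => (Finset.univ : Finset (Composition n)))).finite_toSet.subset ?_
      intro α hα
      simp only [Finset.coe_sigma, Set.mem_sigma_iff, Finset.mem_coe, Finset.mem_range,
        Finset.mem_univ, and_true]
      by_contra hlt
      exact hα (hN _ (by rw [degree_leading]; omega)))
  map_add' f g := by ext α; exact map_add (MvPowerSeries.coeff (leading α)) _ _
  map_smul' c f := by ext α; exact map_smul (MvPowerSeries.coeff (leading α)) _ _

lemma coeffs_M (k : Type u) [CommRing k] (α : Σ n, Composition n) :
    coeffs k (M k α.2) = Finsupp.single α 1 := by
  ext β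
  exact coeff_leading_M k α β

lemma coeffs_bijective (k : Type u) [CommRing k] : Function.Bijective (coeffs k) := by
  constructor
  · rw [injective_iff_map_eq_zero]
    intro f hf
    ext d
    obtain ⟨α, hα⟩ := coeff_eq_coeff_leading f d
    have := congrArg (fun x => x α) hf
    rw [hα]
    exact this
  · intro c
    refine ⟨Finsupp.linearCombination k (fun α : Σ n, Composition n => M k α.2) c, ?_⟩
    rw [Finsupp.linearCombination_apply, Finsupp.sum, map_sum]
    simp only [map_smul, coeffs_M, Finsupp.smul_single, smul_eq_mul, mul_one]
    exact Finsupp.sum_single c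

/-- The basis `(M_α)` of the `k`-module `QSym`, indexed by all compositions. -/
noncomputable def basisM (k : Type u) [CommRing k] :
    Module.Basis (Σ n, Composition n) k (QSym k) :=
  .ofRepr (LinearEquiv.ofBijective (coeffs k) (coeffs_bijective k))

lemma basisM_apply (k : Type u) [CommRing k] (α : Σ n, Composition n) :
    basisM k α = M k α.2 := by
  apply (basisM k).repr.injective
  rw [Module.Basis.repr_self]
  exact (coeffs_M k α).symm

/-- The composition `(α_1, …, α_m)`. -/
def initialPart {n : ℕ} (α : Composition n) (m : ℕ) : Composition (α.blocks.take m).sum :=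
  ⟨α.blocks.take m, fun h => α.blocks_pos (List.mem_of_mem_take h), rfl⟩

/-- The composition `(α_{m+1}, …, α_p)`. -/
def finalPart {n : ℕ} (α : Composition n) (m : ℕ) : Composition (α.blocks.drop m).sum :=
  ⟨α.blocks.drop m, fun h => α.blocks_pos (List.mem_of_mem_drop h), rfl⟩

/-- The coproduct of `QSym`: the `k`-linear map with
`Δ M_α = ∑_{m = 0}^p M_{(α_1, …, α_m)} ⊗ M_{(α_{m+1}, …, α_p)}`. -/
noncomputable def comul (k : Type u) [CommRing k] : QSym k →ₗ[k] QSym k ⊗[k] QSym k :=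
  (basisM k).constr k fun α =>
    ∑ m ∈ range (α.2.length + 1), M k (initialPart α.2 m) ⊗ₜ[k] M k (finalPart α.2 m)

/-- The counit of `QSym`: the constant term. -/
noncomputable def counit (k : Type u) [CommRing k] : QSym k →ₗ[k] k :=
  MvPowerSeries.coeff (0 : ℕ+ →₀ ℕ) ∘ₗ (QSym k).val.toLinearMap

/-- `S` is an antipode of `QSym`: with respect to the product, the coproduct and the counit of
`QSym`, it is a two-sided convolution inverse of the identity map, that is,
`∑ S(f₁) f₂ = ε(f) 1 = ∑ f₁ S(f₂)` where `Δ f = ∑ f₁ ⊗ f₂`. -/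
structure IsAntipode {k : Type u} [CommRing k] (S : QSym k →ₗ[k] QSym k) : Prop where
  left : LinearMap.mul' k (QSym k) ∘ₗ S.rTensor (QSym k) ∘ₗ comul k =
    Algebra.linearMap k (QSym k) ∘ₗ counit k
  right : LinearMap.mul' k (QSym k) ∘ₗ S.lTensor (QSym k) ∘ₗ comul k =
    Algebra.linearMap k (QSym k) ∘ₗ counit k

/-- The set of proper partial sums `Des α = {α_1, α_1 + α_2, …, α_1 + ⋯ + α_{p-1}}`. -/
def Des {n : ℕ} (α : Composition n) : Finset ℕ :=
  (Finset.Ico 1 α.length).image α.sizeUpTo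

/-- The enriched monomial function `η_α = ∑_{Des β ⊆ Des α} 2^{ℓ(β)} M_β`. -/
noncomputable def eta (k : Type u) [CommRing k] {n : ℕ} (α : Composition n) : QSym k :=
  ∑ β : Composition n with Des β ⊆ Des α, (2 : k) ^ β.length • M k β

end QuasiSym

namespace QuasiSym

open Finset

open scoped TensorProduct

universe u

/-! ### Convolution of functions on words -/

section Convolution

variable {τ : Type*} {A : Type*} [CommRing A]

/-! Compositions are words in the positive integers, and functions from words to a commutative ring
form a monoid under `conv`. As Δ deconcatenates the M-basis, S is an antipode exactly when L ↦
S(M_L) is a two-sided convolution inverse of L ↦ M_L (`isAntipode_iff`). Since M of the empty word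
is 1, the inverse can be built by recursion on length, and it is unique.

The coproduct also deconcatenates η (`comul_wordEta`), so L ↦ S(η_L) is a left inverse of L ↦ η_L. A
left inverse equals any right inverse, so it suffices that L ↦ (-1)^{ℓ(L)} η_{rev L} is a right
inverse (`wordEta_conv_signRev`).

For this, restrict to finitely many variables. A term of η_L arises by cutting L into consecutive
blocks, one per variable; a nonempty block B contributes 2 x^{|B|}, where |B| is the sum of B, and
an empty block contributes 1. So η is a convolution product of one `factor` per variable. Each
factor is governed by h(X) = (1 + X)/(1 - X), and h(X) h(-X) = 1 says that its signed reversal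
inverts it (`factor_conv_signRev`). Signed reversal turns products around (`conv_signRev`), so the
inverses telescope. -/

/-- The convolution of two functions on words with respect to deconcatenation. -/
def conv (f g : List τ → A) (L : List τ) : A :=
  ∑ m ∈ range (L.length + 1), f (L.take m) * g (L.drop m)

/-- The unit of the convolution of functions on words. -/
def convOne (L : List τ) : A := if L.isEmpty then 1 else 0

lemma convOne_nil : convOne ([] : List τ) = (1 : A) := rfl

lemma convOne_cons (a : τ) (L : List τ) : convOne (a :: L) = (0 : A) := rfl

lemma conv_nil (f g : List τ → A) : conv f g [] = f [] * g [] := by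
  simp [conv]

/-- Splitting off the cut before the first letter makes convolution accessible to induction on the
word, with the left function generalized. -/
lemma conv_cons (f g : List τ → A) (a : τ) (L : List τ) :
    conv f g (a :: L) = f [] * g (a :: L) + conv (fun u => f (a :: u)) g L := by
  rw [conv, List.length_cons, sum_range_succ', add_comm]
  rfl

lemma conv_add_left (f f' g : List τ → A) (L : List τ) :
    conv (fun u => f u + f' u) g L = conv f g L + conv f' g L := by
  simp [conv, add_mul, sum_add_distrib]

lemma conv_mul_left (c : A) (f g : List τ → A) (L : List τ) :
    conv (fun u => c * f u) g L = c * conv f g L := by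
  simp [conv, mul_sum, mul_assoc]

lemma conv_assoc (f g h : List τ → A) : conv (conv f g) h = conv f (conv g h) := by
  funext L
  induction L generalizing f with
  | nil => simp [conv_nil, mul_assoc]
  | cons a L ih =>
    rw [conv_cons, conv_cons f]
    simp only [conv_cons f g, conv_add_left, conv_mul_left, conv_nil]
    rw [ih, conv_cons g h]
    ring

lemma one_conv (g : List τ → A) : conv convOne g = g := by
  funext L
  cases L with
  | nil => simp [conv_nil, convOne_nil]
  | cons a L =>
    rw [conv_cons]
    simp only [convOne_nil, convOne_cons, conv, one_mul, zero_mul, sum_const_zero, add_zero]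

lemma conv_one (f : List τ → A) : conv f convOne = f := by
  funext L
  induction L generalizing f with
  | nil => simp [conv_nil, convOne_nil]
  | cons a L ih => rw [conv_cons, convOne_cons, ih, mul_zero, zero_add]

lemma conv_left_inv_eq_right_inv {f g h : List τ → A} (hf : conv f g = convOne)
    (hh : conv g h = convOne) : f = h := by
  rw [← conv_one f, ← hh, ← conv_assoc, hf, one_conv]

/-- A cut of the reversed word at m is a cut of L at `L.length - m`, with prefix and suffix
exchanged. Commutativity of `A` puts the factors back in order. -/
lemma conv_reverse (f g : List τ → A) (L : List τ) :
    conv f g L.reverse = conv (fun u => g u.reverse) (fun u => f u.reverse) L := by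
  rw [conv, conv, ← sum_range_reflect, List.length_reverse]
  refine sum_congr rfl fun m hm => ?_
  have hm' : m ≤ L.length := by simpa [Nat.lt_succ_iff] using hm
  rw [mul_comm, List.take_reverse, List.drop_reverse]
  congr 4 <;> omega

/-- The right inverse of `f` with respect to convolution, where `f [] = 1`. -/
def convInv (f : List τ → A) : List τ → A
  | [] => 1
  -- This solves `conv f g (a :: L) = 0` for `g (a :: L)`, whose coefficient is `f [] = 1`.
  | a :: L => -∑ m ∈ range (L.length + 1), f (a :: L.take m) * convInv f (L.drop m)
termination_by L => L.length
decreasing_by simp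

lemma conv_convInv {f : List τ → A} (hf : f [] = 1) : conv f (convInv f) = convOne := by
  funext L
  cases L with
  | nil => simp [conv_nil, hf, convInv, convOne_nil]
  | cons a L => rw [conv_cons, hf, convInv, convOne_cons, conv]; ring

/-- The right inverse itself has a right inverse, which must then be `f`. -/
lemma convInv_conv {f : List τ → A} (hf : f [] = 1) : conv (convInv f) f = convOne := by
  have h : conv (convInv f) (convInv (convInv f)) = convOne := conv_convInv (by simp [convInv])
  rw [← conv_left_inv_eq_right_inv (conv_convInv hf) h] at h
  exact h

end Convolution

/-! ### Compositions as words, and the monomial basis -/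

/-- The composition with a given list of parts. -/
def wordComposition (L : List ℕ+) : Composition (L.map PNat.val).sum :=
  ⟨L.map PNat.val, by
    intro b hb
    obtain ⟨c, -, rfl⟩ := List.mem_map.1 hb
    exact c.pos, rfl⟩

lemma wordComposition_blocks (L : List ℕ+) : (wordComposition L).blocks = L.map PNat.val := rfl

lemma wordComposition_length (L : List ℕ+) : (wordComposition L).length = L.length := by
  simp [Composition.length, wordComposition_blocks]

lemma exists_word {l : List ℕ} (hl : ∀ b ∈ l, 0 < b) : ∃ L : List ℕ+, L.map PNat.val = l := by
  refine ⟨l.map Nat.toPNat', ?_⟩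
  rw [List.map_map]
  refine (List.map_congr_left fun b hb => ?_).trans (List.map_id l)
  exact Nat.succ_pred_eq_of_pos (hl b hb)

lemma map_val_injective : Function.Injective (List.map PNat.val) :=
  List.map_injective_iff.2 PNat.coe_injective

/-- Compositions are the same as words in the positive integers. -/
noncomputable def wordEquiv : List ℕ+ ≃ Σ n, Composition n :=
  Equiv.ofBijective (fun L => ⟨_, wordComposition L⟩) ⟨fun L L' h =>
    map_val_injective (Composition.sigma_eq_iff_blocks_eq.1 h), fun α => by
      obtain ⟨L, hL⟩ := exists_word fun b hb => α.2.blocks_pos hb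
      exact ⟨L, Composition.sigma_eq_iff_blocks_eq.2 hL⟩⟩

lemma sigma_wordComposition {n : ℕ} {α : Composition n} {L : List ℕ+}
    (h : L.map PNat.val = α.blocks) :
    (⟨_, wordComposition L⟩ : Σ n, Composition n) = ⟨n, α⟩ :=
  Composition.sigma_eq_iff_blocks_eq.2 h

/-- The monomial quasisymmetric functions form a basis indexed by words. -/
noncomputable def wordBasis (k : Type u) [CommRing k] : Module.Basis (List ℕ+) k (QSym k) :=
  (basisM k).reindex wordEquiv.symm

/-- The monomial quasisymmetric function of a word. -/
noncomputable def wordM (k : Type u) [CommRing k] (L : List ℕ+) : QSym k :=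
  M k (wordComposition L)

section

variable {k : Type u} [CommRing k]

lemma wordBasis_apply (L : List ℕ+) : wordBasis k L = wordM k L := by
  rw [wordBasis, Module.Basis.reindex_apply, basisM_apply]
  rfl

lemma M_eq_wordM {n : ℕ} {α : Composition n} {L : List ℕ+} (h : L.map PNat.val = α.blocks) :
    M k α = wordM k L :=
  (congrArg (fun β : Σ n, Composition n => M k β.2) (sigma_wordComposition h)).symm

lemma eta_eq_eta_wordComposition {n : ℕ} {α : Composition n} {L : List ℕ+}
    (h : L.map PNat.val = α.blocks) : eta k α = eta k (wordComposition L) :=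
  (congrArg (fun β : Σ n, Composition n => eta k β.2) (sigma_wordComposition h)).symm

lemma coeff_wordM (L : List ℕ+) (d : ℕ+ →₀ ℕ) :
    MvPowerSeries.coeff d (wordM k L : MvPowerSeries ℕ+ k) =
      if flat d = L.map PNat.val then 1 else 0 :=
  coeff_monomialSeries k _ d

/-- The monomial `x_1^{L_1} ⋯ x_p^{L_p}`. -/
noncomputable def wordLeading (L : List ℕ+) : ℕ+ →₀ ℕ := leading ⟨_, wordComposition L⟩

lemma flat_wordLeading (L : List ℕ+) : flat (wordLeading L) = L.map PNat.val := flat_leading _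

lemma wordBasis_repr (f : QSym k) (L : List ℕ+) :
    (wordBasis k).repr f L = MvPowerSeries.coeff (wordLeading L) (f : MvPowerSeries ℕ+ k) := by
  rw [wordBasis, Module.Basis.repr_reindex_apply]
  rfl

lemma flat_pos (d : ℕ+ →₀ ℕ) : ∀ b ∈ flat d, 0 < b := by
  intro b hb
  simp only [flat, List.mem_map, Finset.mem_sort, Finsupp.mem_support_iff] at hb
  obtain ⟨m, hm, rfl⟩ := hb
  omega

lemma flat_zero : flat 0 = [] := by simp [flat]

lemma wordM_nil : wordM k [] = 1 := by
  ext d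
  rw [coeff_wordM, OneMemClass.coe_one, MvPowerSeries.coeff_one]
  congr 1
  refine propext ⟨fun h => ?_, fun h => by rw [h, flat_zero]; rfl⟩
  have : (flat d).sum = 0 := by rw [h]; rfl
  rwa [sum_flat, Finsupp.degree_eq_zero_iff] at this

lemma counit_wordM (L : List ℕ+) : counit k (wordM k L) = convOne L := by
  change MvPowerSeries.coeff 0 (wordM k L : MvPowerSeries ℕ+ k) = _
  rw [coeff_wordM, flat_zero]
  cases L <;> simp [convOne]

lemma comul_wordM (L : List ℕ+) : comul k (wordM k L) =
    ∑ m ∈ range (L.length + 1), wordM k (L.take m) ⊗ₜ[k] wordM k (L.drop m) := by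
  have h := (basisM k).constr_basis k (fun α : Σ n, Composition n =>
    ∑ m ∈ range (α.2.length + 1), M k (initialPart α.2 m) ⊗ₜ[k] M k (finalPart α.2 m))
    ⟨_, wordComposition L⟩
  rw [basisM_apply] at h
  refine h.trans ?_
  rw [wordComposition_length]
  refine sum_congr rfl fun m _ => ?_
  rw [M_eq_wordM (L := L.take m), M_eq_wordM (L := L.drop m)]
  · exact List.map_drop
  · exact List.map_take

lemma convOne_algebraMap (L : List ℕ+) :
    algebraMap k (QSym k) (convOne L) = convOne L := by
  cases L <;> simp [convOne]

/-! ### Existence and uniqueness of the antipode -/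

/-- The antipode axioms in terms of the convolution of functions on words. -/
lemma isAntipode_iff (S : QSym k →ₗ[k] QSym k) : IsAntipode S ↔
    conv (fun L => S (wordM k L)) (wordM k) = convOne ∧
      conv (wordM k) (fun L => S (wordM k L)) = convOne := by
  constructor
  · rintro ⟨hl, hr⟩
    constructor
    · funext L
      have := LinearMap.congr_fun hl (wordM k L)
      simpa [comul_wordM, counit_wordM, convOne_algebraMap, conv] using this
    · funext L
      have := LinearMap.congr_fun hr (wordM k L)
      simpa [comul_wordM, counit_wordM, convOne_algebraMap, conv] using this
  · rintro ⟨hl, hr⟩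
    constructor
    · refine (wordBasis k).ext fun L => ?_
      have := congrFun hl L
      simpa [wordBasis_apply, comul_wordM, counit_wordM, convOne_algebraMap, conv] using this
    · refine (wordBasis k).ext fun L => ?_
      have := congrFun hr L
      simpa [wordBasis_apply, comul_wordM, counit_wordM, convOne_algebraMap, conv] using this

lemma existsUnique_isAntipode : ∃! S : QSym k →ₗ[k] QSym k, IsAntipode S := by
  have key : ∀ L, (wordBasis k).constr k (convInv (wordM k)) (wordM k L) =
      convInv (wordM k) L := fun L => by
    rw [← wordBasis_apply, Module.Basis.constr_basis]
  refine ⟨(wordBasis k).constr k (convInv (wordM k)), ?_, fun S hS => ?_⟩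
  · simp only [isAntipode_iff, key]
    exact ⟨convInv_conv wordM_nil, conv_convInv wordM_nil⟩
  · refine (wordBasis k).ext fun L => ?_
    rw [wordBasis_apply, key]
    exact congrFun (conv_left_inv_eq_right_inv ((isAntipode_iff S).1 hS).1
      (conv_convInv wordM_nil)) L

end

/-! ### Coarsenings and descent sets -/

/-- `f` is obtained from `l` by adding up consecutive entries, where `f` and `l` consist of
positive integers. -/
def Coarsens (f l : List ℕ) : Prop :=
  f.sum = l.sum ∧ ∀ t, ∃ s, (f.take t).sum = (l.take s).sum

lemma coarsens_nil_iff (L : List ℕ+) : Coarsens [] (L.map PNat.val) ↔ L = [] := by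
  constructor
  · rintro ⟨h, -⟩
    cases L with
    | nil => rfl
    | cons a L =>
      have := a.pos
      simp only [List.sum_nil, List.map_cons, List.sum_cons] at h
      omega
  · rintro rfl
    exact ⟨rfl, fun t => ⟨0, by simp⟩⟩

lemma sum_take_add_sum_take_drop (l : List ℕ) (m s : ℕ) :
    (l.take (m + s)).sum = (l.take m).sum + ((l.drop m).take s).sum := by
  rw [List.take_add, List.sum_append]

lemma sum_take_mono (l : List ℕ) {m s : ℕ} (h : m ≤ s) : (l.take m).sum ≤ (l.take s).sum := by
  obtain ⟨r, rfl⟩ := Nat.exists_eq_add_of_le h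
  rw [sum_take_add_sum_take_drop]
  omega

/-- The first block uses up exactly `l.take m`; all later partial sums are shifted by `b`. This is
the recursion behind `etaCoeff`. -/
lemma coarsens_cons_iff {b : ℕ} {f l : List ℕ} {m : ℕ} (hm : (l.take m).sum = b) :
    Coarsens (b :: f) l ↔ Coarsens f (l.drop m) := by
  have hl : l.sum = b + (l.drop m).sum := by rw [← hm, List.sum_take_add_sum_drop]
  rw [Coarsens, Coarsens, hl, List.sum_cons, add_right_inj]
  refine and_congr_right fun _ => ⟨fun h t => ?_, fun h t => ?_⟩
  · obtain ⟨s, hs⟩ := h (t + 1)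
    rw [List.take_succ_cons, List.sum_cons] at hs
    rcases le_total m s with h' | h'
    · obtain ⟨r, rfl⟩ := Nat.exists_eq_add_of_le h'
      rw [sum_take_add_sum_take_drop] at hs
      exact ⟨r, by omega⟩
    -- Here a partial sum of `l` that is at most `b` equals `b` plus a partial sum of `f`, so the
    -- latter is 0.
    · have := sum_take_mono l h'
      exact ⟨0, by simp only [List.take_zero, List.sum_nil]; omega⟩
  · cases t with
    | zero => exact ⟨0, rfl⟩
    | succ t =>
      obtain ⟨s, hs⟩ := h t
      refine ⟨m + s, ?_⟩
      rw [List.take_succ_cons, List.sum_cons, sum_take_add_sum_take_drop, hs, hm]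

lemma sum_map_val_pos {L : List ℕ+} (h : L ≠ []) : 0 < (L.map PNat.val).sum := by
  cases L with
  | nil => exact absurd rfl h
  | cons a L =>
    have := a.pos
    simp only [List.map_cons, List.sum_cons]
    omega

lemma sum_take_strictMono (L : List ℕ+) {m s : ℕ} (h : m < s) (hm : m < L.length) :
    ((L.map PNat.val).take m).sum < ((L.map PNat.val).take s).sum := by
  obtain ⟨r, rfl⟩ := Nat.exists_eq_add_of_lt h
  rw [add_assoc, sum_take_add_sum_take_drop]
  suffices h : 0 < (((L.map PNat.val).drop m).take (r + 1)).sum by omega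
  rw [← List.map_drop, ← List.map_take]
  have : (L.drop m).take (r + 1) ≠ [] := by
    simp only [ne_eq, List.take_eq_nil_iff, List.drop_eq_nil_iff]
    omega
  exact sum_map_val_pos this

lemma sum_take_injOn (L : List ℕ+) {m s : ℕ} (hm : m ≤ L.length) (hs : s ≤ L.length)
    (h : ((L.map PNat.val).take m).sum = ((L.map PNat.val).take s).sum) : m = s := by
  rcases lt_trichotomy m s with h' | h' | h'
  · have := sum_take_strictMono L h' (by omega); omega
  · exact h'
  · have := sum_take_strictMono L h' (by omega); omega

/-- `Coarsens` also compares the trivial partial sums 0 and n, which always match. A partial sum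
strictly between them comes from an index strictly between 0 and the length, as `Des` demands. -/
lemma des_subset_iff {n : ℕ} (α β : Composition n) :
    Des β ⊆ Des α ↔ Coarsens β.blocks α.blocks := by
  constructor
  · intro h
    refine ⟨by rw [α.blocks_sum, β.blocks_sum], fun t => ?_⟩
    rcases Nat.eq_zero_or_pos t with rfl | h0
    · exact ⟨0, by simp⟩
    rcases lt_or_ge t β.length with ht | ht
    · have : β.sizeUpTo t ∈ Des β := mem_image_of_mem _ (mem_Ico.2 ⟨h0, ht⟩)
      obtain ⟨s, -, hs⟩ := mem_image.1 (h this)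
      exact ⟨s, hs.symm⟩
    · refine ⟨α.length, ?_⟩
      exact (β.sizeUpTo_ofLength_le t ht).trans α.sizeUpTo_length.symm
  · rintro ⟨-, h⟩ x hx
    obtain ⟨t, ht, rfl⟩ := mem_image.1 hx
    rw [mem_Ico] at ht
    obtain ⟨s, hs⟩ := h t
    change β.sizeUpTo t = α.sizeUpTo s at hs
    have h1 : 0 < β.sizeUpTo t := by
      have h2 := β.sizeUpTo_strict_mono (i := 0) (by omega)
      have h3 := β.monotone_sizeUpTo (show 0 + 1 ≤ t from ht.1)
      omega
    have h2 : β.sizeUpTo t < n := by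
      have h2 := β.sizeUpTo_strict_mono ht.2
      have h3 := β.sizeUpTo_le (t + 1)
      omega
    refine mem_image.2 ⟨s, mem_Ico.2 ⟨?_, ?_⟩, hs.symm⟩
    · by_contra h0
      have : s = 0 := by omega
      rw [hs, this, α.sizeUpTo_zero] at h1
      exact lt_irrefl _ h1
    · by_contra h0
      rw [hs, α.sizeUpTo_ofLength_le s (by omega)] at h2
      exact lt_irrefl _ h2

/-! ### Coefficients and coproduct of η -/

section

variable {k : Type u} [CommRing k]

open Classical in
lemma coeff_eta {n : ℕ} (α : Composition n) (d : ℕ+ →₀ ℕ) :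
    MvPowerSeries.coeff d (eta k α : MvPowerSeries ℕ+ k) =
      if Coarsens (flat d) α.blocks then 2 ^ (flat d).length else 0 := by
  have hsum : MvPowerSeries.coeff d (eta k α : MvPowerSeries ℕ+ k) =
      ∑ β : Composition n, if Coarsens β.blocks α.blocks ∧ flat d = β.blocks
        then (2 : k) ^ (flat d).length else 0 := by
    rw [eta, AddSubmonoidClass.coe_finsetSum, map_sum, sum_filter]
    refine sum_congr rfl fun β _ => ?_
    simp only [des_subset_iff, ite_and]
    congr 1
    change MvPowerSeries.coeff d ((2 : k) ^ β.length • monomialSeries k β) = _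
    rw [map_smul, coeff_monomialSeries, smul_eq_mul, mul_ite, mul_one, mul_zero]
    split_ifs with h
    · rw [h, β.blocks_length]
    · rfl
  rw [hsum]
  split_ifs with h
  -- Only the composition read off from the monomial itself contributes.
  · let β : Composition n := ⟨flat d, fun {i} hi => flat_pos d i hi, h.1.trans α.blocks_sum⟩
    rw [sum_eq_single β, if_pos ⟨h, rfl⟩]
    · intro γ _ hγ
      rw [if_neg]
      exact fun h' => hγ (Composition.ext h'.2.symm)
    · exact fun h' => absurd (mem_univ _) h'
  · refine sum_eq_zero fun β _ => if_neg ?_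
    rintro ⟨h1, h2⟩
    exact h (h2 ▸ h1)

/-- The coefficients of the power series `(1 + X) / (1 - X)`. -/
def doubling (k : Type u) [CommRing k] (n : ℕ) : k := if n = 0 then 1 else 2

/-- The contribution of a single part `b` of a coarsening. -/
def blockWeight (k : Type u) [CommRing k] (b : ℕ) (L : List ℕ+) : k :=
  if (L.map PNat.val).sum = b then doubling k L.length else 0

/-- The coefficient of a monomial with exponents `f` in `η_L`. -/
def etaCoeff (k : Type u) [CommRing k] : List ℕ → List ℕ+ → k
  | [] => convOne
  | b :: f => conv (blockWeight k b) (etaCoeff k f)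

lemma etaCoeff_append (f g : List ℕ) :
    etaCoeff k (f ++ g) = conv (etaCoeff k f) (etaCoeff k g) := by
  induction f with
  | nil => rw [etaCoeff, one_conv, List.nil_append]
  | cons b f ih => rw [List.cons_append, etaCoeff, etaCoeff, ih, conv_assoc]

lemma blockWeight_zero : blockWeight k 0 = convOne := by
  funext L
  cases L with
  | nil => simp [blockWeight, doubling, convOne_nil]
  | cons a L =>
    have := sum_map_val_pos (List.cons_ne_nil a L)
    rw [blockWeight, if_neg this.ne', convOne_cons]

/-- A zero exponent forces an empty block, which contributes the convolution unit. -/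
lemma etaCoeff_filter (f : List ℕ) : etaCoeff k (f.filter (· ≠ 0)) = etaCoeff k f := by
  induction f with
  | nil => rfl
  | cons b f ih =>
    by_cases hb : b = 0
    · subst hb
      rw [etaCoeff, blockWeight_zero, one_conv, ← ih]
      rfl
    · rw [List.filter_cons_of_pos (by simpa using hb), etaCoeff, etaCoeff, ih]

-- The parts of `L` are positive, so at most one prefix of `L` has sum `b`, and the convolution has
-- at most one nonzero term. Since `b > 0`, that prefix is nonempty and contributes a factor 2.
open Classical in
lemma etaCoeff_eq {f : List ℕ} (hf : ∀ b ∈ f, 0 < b) (L : List ℕ+) :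
    etaCoeff k f L = if Coarsens f (L.map PNat.val) then 2 ^ f.length else 0 := by
  induction f generalizing L with
  | nil =>
    rw [coarsens_nil_iff]
    cases L <;> simp [etaCoeff, convOne]
  | cons b f ih =>
    have hf' : ∀ b ∈ f, 0 < b := fun c hc => hf c (List.mem_cons_of_mem _ hc)
    have hb : 0 < b := hf b List.mem_cons_self
    rw [etaCoeff, conv]
    by_cases hm : ∃ m ≤ L.length, ((L.map PNat.val).take m).sum = b
    · obtain ⟨m, hmL, hm⟩ := hm
      have hm0 : m ≠ 0 := by
        rintro rfl
        simp at hm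
        omega
      rw [sum_eq_single m, ih hf', coarsens_cons_iff hm, blockWeight, List.map_take, if_pos hm,
        doubling, List.length_take, if_neg (by omega), List.map_drop, mul_ite, mul_zero,
        List.length_cons, pow_succ']
      · intro s hs hsm
        rw [blockWeight, if_neg, zero_mul]
        rw [List.map_take, ← hm]
        rw [mem_range] at hs
        exact fun h => hsm (sum_take_injOn L (by omega) hmL h)
      · intro h
        rw [mem_range] at h
        omega
    · rw [if_neg]
      · refine sum_eq_zero fun m hmL => ?_
        rw [mem_range] at hmL
        rw [blockWeight, if_neg, zero_mul]
        rw [List.map_take]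
        exact fun h => hm ⟨m, by omega, h⟩
      · rintro ⟨-, h⟩
        -- The partial sum at index 1 is `b`, so some prefix of `L` would have sum `b` after all.
        obtain ⟨s, hs⟩ := h 1
        simp only [List.take_succ_cons, List.take_zero, List.sum_cons, List.sum_nil,
          add_zero] at hs
        rcases le_total s L.length with h' | h'
        · exact hm ⟨s, h', hs.symm⟩
        · refine hm ⟨L.length, le_rfl, ?_⟩
          rw [hs, List.take_of_length_le (by simp), List.take_of_length_le (by simpa using h')]

/-- The enriched monomial function of a word. -/
noncomputable def wordEta (k : Type u) [CommRing k] (L : List ℕ+) : QSym k :=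
  eta k (wordComposition L)

lemma coeff_wordEta (L : List ℕ+) (d : ℕ+ →₀ ℕ) :
    MvPowerSeries.coeff d (wordEta k L : MvPowerSeries ℕ+ k) = etaCoeff k (flat d) L := by
  classical
  rw [wordEta, coeff_eta, etaCoeff_eq (flat_pos d), wordComposition_blocks]

lemma wordBasis_repr_eta (L β : List ℕ+) :
    (wordBasis k).repr (wordEta k L) β = etaCoeff k (β.map PNat.val) L := by
  rw [wordBasis_repr, coeff_wordEta, flat_wordLeading]

/-- A word has exactly one cut into `β` and `γ` if it is `β ++ γ`, and none otherwise. Thus Δ is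
dual to concatenation. -/
lemma repr_comul (f : QSym k) (β γ : List ℕ+) :
    ((wordBasis k).tensorProduct (wordBasis k)).repr (comul k f) (β, γ) =
      (wordBasis k).repr f (β ++ γ) := by
  classical
  let φ : QSym k →ₗ[k] k := Finsupp.lapply (β, γ) ∘ₗ
    ((wordBasis k).tensorProduct (wordBasis k)).repr.toLinearMap ∘ₗ comul k
  let ψ : QSym k →ₗ[k] k := Finsupp.lapply (β ++ γ) ∘ₗ (wordBasis k).repr.toLinearMap
  suffices h : φ = ψ from LinearMap.congr_fun h f
  refine (wordBasis k).ext fun L => ?_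
  change ((wordBasis k).tensorProduct (wordBasis k)).repr (comul k (wordBasis k L)) (β, γ) =
    (wordBasis k).repr (wordBasis k L) (β ++ γ)
  rw [Module.Basis.repr_self, wordBasis_apply, comul_wordM, map_sum, Finsupp.finsetSum_apply]
  simp only [← wordBasis_apply, Module.Basis.tensorProduct_repr_tmul_apply,
    Module.Basis.repr_self, Finsupp.single_apply, smul_eq_mul]
  by_cases hL : L = β ++ γ
  · subst hL
    rw [sum_eq_single β.length]
    · simp
    · intro m hm hne
      rw [mem_range] at hm
      have : (β ++ γ).take m ≠ β := by
        intro h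
        have := congrArg List.length h
        rw [List.length_take] at this
        omega
      simp [this]
    · intro h
      simp at h
  · rw [if_neg hL]
    refine sum_eq_zero fun m _ => ?_
    by_cases h1 : L.take m = β
    · have : L.drop m ≠ γ := fun h2 => hL (by rw [← h1, ← h2, List.take_append_drop])
      simp [this]
    · simp [h1]

/-- The coproduct of `η` is deconcatenation. -/
lemma comul_wordEta (L : List ℕ+) : comul k (wordEta k L) =
    ∑ m ∈ range (L.length + 1), wordEta k (L.take m) ⊗ₜ[k] wordEta k (L.drop m) := by
  apply ((wordBasis k).tensorProduct (wordBasis k)).repr.injective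
  ext ⟨β, γ⟩
  -- The coefficient at `(β, γ)` is that of `β ++ γ` in η; `etaCoeff_append` splits it into the
  -- deconcatenation sum.
  rw [repr_comul, wordBasis_repr_eta, List.map_append, etaCoeff_append, map_sum,
    Finsupp.finsetSum_apply]
  refine sum_congr rfl fun m _ => ?_
  rw [Module.Basis.tensorProduct_repr_tmul_apply, wordBasis_repr_eta, wordBasis_repr_eta,
    smul_eq_mul, mul_comm]

lemma counit_wordEta (L : List ℕ+) : counit k (wordEta k L) = convOne L := by
  change MvPowerSeries.coeff 0 (wordEta k L : MvPowerSeries ℕ+ k) = _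
  rw [coeff_wordEta, flat_zero, etaCoeff]

lemma IsAntipode.conv_wordEta {S : QSym k →ₗ[k] QSym k} (hS : IsAntipode S) :
    conv (fun L => S (wordEta k L)) (wordEta k) = convOne := by
  funext L
  have := LinearMap.congr_fun hS.left (wordEta k L)
  simpa [comul_wordEta, counit_wordEta, convOne_algebraMap, conv] using this

end

/-! ### Signed reversal -/

section

variable {τ : Type*} {A : Type*} [CommRing A]

/-- Reverse the argument and multiply by the sign of its length. -/
def signRev (f : List τ → A) (L : List τ) : A := (-1) ^ L.length * f L.reverse

/-- The sign is multiplicative over each cut, and reversal exchanges the two factors. -/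
lemma conv_signRev (f g : List τ → A) :
    conv (signRev f) (signRev g) = signRev (conv g f) := by
  funext L
  rw [signRev, conv_reverse, conv, conv, mul_sum]
  refine sum_congr rfl fun m hm => ?_
  have hL : (-1 : A) ^ L.length = (-1) ^ (L.take m).length * (-1) ^ (L.drop m).length := by
    rw [← pow_add, ← List.length_append, List.take_append_drop]
  rw [signRev, signRev, hL]
  ring

lemma signRev_convOne : signRev (convOne : List τ → A) = convOne := by
  funext L
  cases L <;> simp [signRev, convOne]

end

/-! ### The generating function of η and its inverse -/

section

variable {k : Type u} [CommRing k]

/-- The factor of the generating function of `η` that belongs to the variable `x_i`. -/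
noncomputable def factor (k : Type u) [CommRing k] (i : ℕ+) (L : List ℕ+) : MvPowerSeries ℕ+ k :=
  MvPowerSeries.monomial (Finsupp.single i (L.map PNat.val).sum) (doubling k L.length)

/-- The generating function of `η` in the variables with indices `I`. -/
noncomputable def etaSeries (k : Type u) [CommRing k] : List ℕ+ → List ℕ+ → MvPowerSeries ℕ+ k
  | [] => convOne
  | i :: I => conv (factor k i) (etaSeries k I)

lemma factor_eq (i : ℕ+) (L : List ℕ+) : factor k i L =
    (if L = [] then 1 else 2) * MvPowerSeries.X i ^ (L.map PNat.val).sum := by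
  classical
  rw [factor, MvPowerSeries.X_pow_eq, ← smul_eq_mul (if L = [] then 1 else 2)]
  cases L with
  | nil => simp [doubling]
  | cons a L =>
    have h : (2 : MvPowerSeries ℕ+ k) = MvPowerSeries.C 2 :=
      (map_ofNat MvPowerSeries.C 2).symm
    rw [if_neg (List.cons_ne_nil a L), h, smul_eq_mul, ← MvPowerSeries.smul_eq_C_mul, ← map_smul]
    simp [doubling]

/-- Both factors depend only on the length and the sum of the word. The power of `X i` comes out,
and the dependence on length reduces to (1 + X)/(1 - X) · (1 - X)/(1 + X) = 1. -/
lemma factor_conv_signRev (i : ℕ+) : conv (factor k i) (signRev (factor k i)) = convOne := by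
  have hs : ∀ a : ℕ+, ∀ L, signRev (factor k i) (a :: L) =
      (-1) ^ (L.length + 1) * (2 * MvPowerSeries.X i ^ ((a : ℕ) + (L.map PNat.val).sum)) := by
    intro a L
    rw [signRev, factor_eq, if_neg (by simp), List.map_reverse, List.sum_reverse]
    rfl
  -- In generating functions by length: 2/(1 - X) · (1 - X)/(1 + X) = 2/(1 + X).
  have hc : ∀ L : List ℕ+, conv
      (fun u => 2 * MvPowerSeries.X i ^ (u.map PNat.val).sum) (signRev (factor k i)) L =
      2 * (-1) ^ L.length * MvPowerSeries.X i ^ (L.map PNat.val).sum := by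
    intro L
    induction L with
    | nil => simp [conv_nil, signRev, factor_eq]
    | cons a L ih =>
      simp only [conv_cons, List.map_cons, List.sum_cons, pow_add,
        mul_left_comm (2 : MvPowerSeries ℕ+ k)]
      rw [conv_mul_left, ih, hs]
      simp only [List.map_nil, List.sum_nil, List.length_cons]
      ring
  funext L
  cases L with
  | nil => simp [conv_nil, signRev, factor_eq, convOne]
  | cons a L =>
    have h : (fun u => factor k i (a :: u)) = fun u => MvPowerSeries.X i ^ (a : ℕ) *
        (2 * MvPowerSeries.X i ^ (u.map PNat.val).sum) := by
      funext u
      rw [factor_eq, if_neg (List.cons_ne_nil a u), List.map_cons, List.sum_cons, pow_add]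
      ring
    rw [conv_cons, h, conv_mul_left, hc, hs, factor_eq, if_pos rfl, convOne_cons]
    simp only [List.map_nil, List.sum_nil]
    ring

lemma etaSeries_conv_signRev (I : List ℕ+) :
    conv (etaSeries k I) (signRev (etaSeries k I)) = convOne := by
  induction I with
  | nil => rw [etaSeries, signRev_convOne, one_conv]
  | cons i I ih =>
    rw [etaSeries, ← conv_signRev, conv_assoc, ← conv_assoc (etaSeries k I), ih, one_conv,
      factor_conv_signRev]

/-- `P` does not involve the variable `i`, so the monomial must supply the whole exponent `d i`. -/
lemma coeff_monomial_single_mul {i : ℕ+} {P : MvPowerSeries ℕ+ k}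
    (hP : ∀ e : ℕ+ →₀ ℕ, e i ≠ 0 → MvPowerSeries.coeff e P = 0) (d : ℕ+ →₀ ℕ) (a : ℕ) (c : k) :
    MvPowerSeries.coeff d (MvPowerSeries.monomial (Finsupp.single i a) c * P) =
      (if a = d i then c else 0) * MvPowerSeries.coeff (d.erase i) P := by
  classical
  rw [MvPowerSeries.coeff_monomial_mul]
  simp only [Finsupp.single_le_iff]
  by_cases h : a = d i
  · subst h
    have he : d.erase i = d - Finsupp.single i (d i) := by
      ext m
      by_cases hm : m = i
      · simp [hm]
      · simp [Finsupp.erase_ne hm, Finsupp.single_eq_of_ne hm]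
    rw [if_pos le_rfl, if_pos rfl, he]
  · rw [if_neg h, zero_mul]
    split_ifs with h'
    · rw [hP, mul_zero]
      rw [Finsupp.tsub_apply, Finsupp.single_eq_same]
      omega
    · rfl

-- As the variables are distinct, only the factor of `i` can produce powers of `X i`; its block must
-- have sum `d i`, which is what `blockWeight` records.
open Classical in
lemma coeff_etaSeries {I : List ℕ+} (hI : I.Nodup) (d : ℕ+ →₀ ℕ) (L : List ℕ+) :
    MvPowerSeries.coeff d (etaSeries k I L) =
      if ∀ m, d m ≠ 0 → m ∈ I then etaCoeff k (I.map d) L else 0 := by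
  induction I generalizing d L with
  | nil =>
    have h : (∀ m, d m ≠ 0 → m ∈ ([] : List ℕ+)) ↔ d = 0 := by
      simp [Finsupp.ext_iff]
    simp only [h, List.map_nil, etaSeries, etaCoeff]
    cases L with
    | nil => rw [convOne_nil, convOne_nil, MvPowerSeries.coeff_one]
    | cons a L => rw [convOne_cons, convOne_cons, map_zero, ite_self]
  | cons i I ih =>
    rw [List.nodup_cons] at hI
    have hmap : I.map (d.erase i) = I.map d := by
      refine List.map_congr_left fun m hm => Finsupp.erase_ne ?_
      rintro rfl
      exact hI.1 hm
    have hmem : (∀ m, d.erase i m ≠ 0 → m ∈ I) ↔ ∀ m, d m ≠ 0 → m ∈ i :: I := by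
      refine forall_congr' fun m => ?_
      by_cases hm : m = i
      · simp [hm]
      · simp [Finsupp.erase_ne hm, hm]
    rw [etaSeries, conv, map_sum]
    have hterm : ∀ m, MvPowerSeries.coeff d
        (factor k i (L.take m) * etaSeries k I (L.drop m)) =
        blockWeight k (d i) (L.take m) *
          if ∀ m, d m ≠ 0 → m ∈ i :: I then etaCoeff k (I.map d) (L.drop m) else 0 := by
      intro m
      rw [factor, coeff_monomial_single_mul, ih hI.2, hmap, blockWeight]
      · simp only [hmem]
      · intro e he
        rw [ih hI.2, if_neg fun h => hI.1 (h i he)]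
    simp only [hterm]
    split_ifs
    · rfl
    · simp

/-- The coefficients of `η` at monomials in the variables `x_{i_1}, …, x_{i_p}` are those of the
generating function. -/
lemma coeff_wordEta_eq {p : ℕ} {i : Fin p → ℕ+} (hi : StrictMono i) (a : Fin p → ℕ)
    (L : List ℕ+) : MvPowerSeries.coeff (expo i a) (wordEta k L : MvPowerSeries ℕ+ k) =
      MvPowerSeries.coeff (expo i a) (etaSeries k (List.ofFn i) L) := by
  classical
  -- `flat` drops the zero exponents, whereas the generating function keeps one entry per variable;
  -- `etaCoeff_filter` reconciles them.
  rw [coeff_wordEta, coeff_etaSeries (List.nodup_ofFn.2 hi.injective), if_pos, flat_expo hi,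
    etaCoeff_filter, List.map_ofFn]
  · congr 2
    funext j
    exact (expo_apply hi.injective a j).symm
  · intro m hm
    by_contra h
    exact hm (expo_apply_of_notMem a fun h' => h (List.mem_ofFn.2 h'))

lemma wordEta_conv_signRev : conv (wordEta k) (signRev (wordEta k)) = convOne := by
  funext L
  apply Subtype.ext
  ext d
  obtain ⟨p, i, a, hi, rfl⟩ : ∃ (p : ℕ) (i : Fin p → ℕ+) (a : Fin p → ℕ),
      StrictMono i ∧ d = expo i a := by
    -- The variables are chosen to be those occurring in the monomial. Its coefficient in a product
    -- involves only monomials in these variables, where η and `etaSeries` agree.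
    let i := d.support.orderEmbOfFin rfl
    refine ⟨_, i, fun j => d (i j), i.strictMono, (expo_comp_self i.injective d fun m hm => ?_).symm⟩
    rw [Finset.range_orderEmbOfFin] at hm
    simpa using hm
  have hsign : ∀ u : List ℕ+, ((signRev (wordEta k) u : QSym k) : MvPowerSeries ℕ+ k) =
      (-1) ^ u.length * (wordEta k u.reverse : MvPowerSeries ℕ+ k) := fun u => by
    simp [signRev]
  have hcoeff : ∀ (b : Fin p → ℕ) (n : ℕ) (f : MvPowerSeries ℕ+ k),
      MvPowerSeries.coeff (expo i b) ((-1) ^ n * f) =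
        (-1) ^ n * MvPowerSeries.coeff (expo i b) f := by
    intro b n f
    rcases Nat.even_or_odd n with h' | h' <;> simp [h'.neg_one_pow]
  have hone : ((convOne L : QSym k) : MvPowerSeries ℕ+ k) = convOne L := by
    cases L <;> simp [convOne]
  rw [hone, ← etaSeries_conv_signRev (List.ofFn i), conv, conv, AddSubmonoidClass.coe_finsetSum,
    map_sum, map_sum]
  refine sum_congr rfl fun m _ => ?_
  rw [MulMemClass.coe_mul, coeff_mul_expo _ _ hi.injective, coeff_mul_expo _ _ hi.injective]
  refine sum_congr rfl fun q _ => ?_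
  rw [hsign, signRev, hcoeff, hcoeff, coeff_wordEta_eq hi, coeff_wordEta_eq hi]

lemma IsAntipode.apply_wordEta {S : QSym k →ₗ[k] QSym k} (hS : IsAntipode S) (L : List ℕ+) :
    S (wordEta k L) = (-1) ^ L.length * wordEta k L.reverse :=
  congrFun (conv_left_inv_eq_right_inv hS.conv_wordEta wordEta_conv_signRev) L

end

end QuasiSym

theorem mainTheorem6 (k : Type*) [CommRing k] :
    (∃! S : QSym k →ₗ[k] QSym k, QuasiSym.IsAntipode S) ∧
      ∀ S : QSym k →ₗ[k] QSym k, QuasiSym.IsAntipode S →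
        ∀ (n : ℕ) (α : Composition n),
          S (QuasiSym.eta k α) = (-1 : k) ^ α.length • QuasiSym.eta k α.reverse := by
  refine ⟨QuasiSym.existsUnique_isAntipode, fun S hS n α => ?_⟩
  obtain ⟨L, hL⟩ := QuasiSym.exists_word fun b hb => α.blocks_pos hb
  have hL' : L.reverse.map PNat.val = α.reverse.blocks := by
    rw [List.map_reverse, hL]
    rfl
  have hlen : α.length = L.length := by
    rw [← α.blocks_length, ← hL, List.length_map]
  rw [QuasiSym.eta_eq_eta_wordComposition hL, QuasiSym.eta_eq_eta_wordComposition hL', hlen]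
  refine (hS.apply_wordEta L).trans ?_
  rw [Algebra.smul_def, map_pow, map_neg, map_one]
  rfl
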